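/- For a finite connected graph $\Gamma$ (simple, each edge of length $1$), orient its edges arbitrarily, let $\mathcal C(\Gamma,\mathbb R)$ be the space of real $1$-chains with the oriented edges as orthonormal basis, and let the Jacobian $\Lambda(\Gamma)$ be the lattice $H_1(\Gamma,\mathbb Z)$ in the Euclidean subspace $H_1(\Gamma,\mathbb R)\subset\mathcal C(\Gamma,\mathbb R)$, whose dimension $b$ is the first Betti number of $\Gamma$. For a lattice $\Lambda$ in an $n$-dimensional Euclidean space, let $$\mu(\Lambda)=\frac{\min\{\langle\lambda,\lambda\rangle : \lambda\in\Lambda\setminus\{0\}\}}{\det(\Lambda)^{1/n}}$$ be its Hermite invariant, where $\det(\Lambda)$ is the square of the volume of a fundamental domain. For real sequences write $f_m\gtrsim g_m$ if for every $\varepsilon>0$ one has $f_m\ge(1-\varepsilon)g_m$ for all sufficiently large $m$. (i) There is an infinite family $(G_m)_{m\ge 0}$ of finite connected $3$-regular graphs whose first Betti numbers $b_m$ are strictly increasing, such that $$\operatorname{girth}(G_m)\gtrsim\tfrac43\log_2 b_m\qquad\text{and}\qquad \mu(\Lambda(G_m))\gtrsim\frac{4}{9e}\log_2 b_m .$$ (ii)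 Moreover, for every sequence $(G_m)$ of finite connected $3$-regular graphs whose first Betti numbers $b_m$ tend to infinity and such that $\operatorname{girth}(G_m)\gtrsim\frac43\log_2 b_m$ (in particular for Margulis's family), one has $\mu(\Lambda(G_m))\gtrsim\frac{4}{9e}\log_2 b_m$. -/

import Mathlib

open Filter Topology MeasureTheory

noncomputable section

namespace GraphJacobian

/-! ### Hermite invariant of a lattice in a Euclidean space -/

section Lattice

variable {E : Type*} [NormedAddCommGroup E] [InnerProductSpace ℝ E]

/-- The minimal norm of a lattice `L`: the least value of `⟨x, x⟩` over the nonzero `x ∈ L`. -/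
def minNorm (L : Submodule ℤ E) : ℝ :=
  sInf {r : ℝ | ∃ x ∈ L, x ≠ 0 ∧ r = inner ℝ x x}

variable [FiniteDimensional ℝ E] [MeasurableSpace E] [BorelSpace E]

/-- The determinant of a lattice: the square of the Euclidean volume of a fundamental domain.
Here `volume` is the Lebesgue measure of the Euclidean space `E`
(a unit cube of an orthonormal basis has volume one). -/
def latticeDet (L : Submodule ℤ E) : ℝ :=
  ZLattice.covolume L volume ^ 2

/-- The Hermite invariant: the minimal norm divided by the `n`-th root of the determinant,
where `n` is the dimension of `E`. -/
def hermiteInvariant (L : Submodule ℤ E) : ℝ :=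
  minNorm L / latticeDet L ^ (1 / (Module.finrank ℝ E : ℝ))

end Lattice

/-! ### Homology and Jacobian of a finite combinatorial graph -/

section Graph

variable {V : Type*} (G : SimpleGraph V)

/-- The real simplicial `1`-chains. As a Euclidean space it has the edges as an orthonormal
basis, which is the inner product for the weight function constant equal to `1`. -/
abbrev Chain : Type _ := EuclideanSpace ℝ G.edgeSet

/-- The origin of an edge, for an arbitrarily chosen orientation of the edges. -/
def origin (e : G.edgeSet) : V := (Quot.out (e : Sym2 V)).1

/-- The end point of an edge, for the same orientation. -/
def terminus (e : G.edgeSet) : V := (Quot.out (e : Sym2 V)).2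

/-- The two end points given by the orientation are those of the edge. -/
theorem origin_terminus (e : G.edgeSet) : s(origin G e, terminus G e) = (e : Sym2 V) :=
  Quot.out_eq (e : Sym2 V)

variable [Fintype V] [DecidableEq V] [DecidableRel G.Adj]

/-- The simplicial boundary map: an oriented edge is sent to its end point minus its origin. -/
def boundary : Chain G →ₗ[ℝ] (V → ℝ) where
  toFun x := ∑ e : G.edgeSet,
    x e • (Pi.single (terminus G e) (1 : ℝ) - Pi.single (origin G e) (1 : ℝ))
  map_add' x y := by simp [add_smul, Finset.sum_add_distrib]
  map_smul' c x := by simp [mul_smul, Finset.smul_sum]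

/-- The first real homology of the graph, as a subspace of the space of chains, with the
induced inner product. -/
abbrev realHomology : Submodule ℝ (Chain G) := LinearMap.ker (boundary G)

/-- The first Betti number. -/
def betti : ℕ := Module.finrank ℝ (realHomology G)

/-- The Jacobian of the combinatorial graph `G`: the first integral homology (the cycles with
integer coefficients), as a lattice in the first real homology. -/
def jacobian : Submodule ℤ (realHomology G) where
  carrier := {x | ∀ e : G.edgeSet, ∃ k : ℤ, (x : Chain G) e = k}
  zero_mem' _ := ⟨0, by simp⟩
  add_mem' {x y} hx hy e := by
    obtain ⟨k, hk⟩ := hx e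
    obtain ⟨l, hl⟩ := hy e
    exact ⟨k + l, by simp [hk, hl]⟩
  smul_mem' c x hx e := by
    obtain ⟨k, hk⟩ := hx e
    exact ⟨c * k, by simp [hk]⟩

end Graph

/-! ### Asymptotic inequality and the families of graphs -/

/-- `f ≳ g`: asymptotically `f` is at least `g`, that is, for every `ε > 0` one has
`f m ≥ (1 - ε) g m` for all large `m`. -/
def AsympGE (f g : ℕ → ℝ) : Prop :=
  ∀ ε : ℝ, 0 < ε → ∀ᶠ m in atTop, (1 - ε) * g m ≤ f m

/-- A sequence of finite connected `3`-regular graphs `G m` whose first Betti numbers `b m` tend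
to infinity and whose girths are asymptotically at least `(4 / 3) log₂ (b m)`. -/
structure IsLargeGirthCubicFamily {V : ℕ → Type*} [∀ m, Fintype (V m)] [∀ m, DecidableEq (V m)]
    (G : ∀ m, SimpleGraph (V m)) [∀ m, DecidableRel (G m).Adj] : Prop where
  connected : ∀ m, (G m).Connected
  regular : ∀ m, (G m).IsRegularOfDegree 3
  betti_tendsto : Tendsto (fun m => betti (G m)) atTop atTop
  girth : AsympGE (fun m => ((G m).girth : ℝ))
    (fun m => 4 / 3 * Real.logb 2 (betti (G m) : ℝ))

end GraphJacobian

end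

/-! For a cubic graph, μ ≥ girth/(3e), and both claims follow from this bound. A nonzero integral
flow has a cycle in its support and squared coefficients at least 1 there, so the minimal norm is at
least the girth (`girth_le_minNorm`). By Cauchy–Binet, b! times the determinant is a sum of squared
minors of the cycle matrix over |E|^b row choices. Each square is at most 1
(`det_cycleMatrix_sq_le`) and |E| ≤ 3b, so the determinant is at most (3b)^b/b! ≤ (3e)^b.

For existence, cubic graphs are built from the three norm-two quaternions 1 + ω^a j, ω = i - 1, and
their conjugates, acting on projective units modulo a prime q. A cycle of length 2k gives an
integral quaternion of norm 2^(2k), primitive at 2 and scalar modulo q. Factoring a difference of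
squares then yields q² ≤ 4·2^k (`pow_four_le_of_scalar_mod`), so the girth is at least 4 log₂ q - 4,
while b = O(q³). This gives the ratio 4/3. -/

/-- A symmetrised Cauchy–Binet formula for the Gram determinant. -/
theorem Matrix.sum_det_submatrix_sq {ι κ R : Type*} [Fintype ι] [DecidableEq ι] [Fintype κ]
    [CommRing R] (B : Matrix κ ι R) :
    ∑ f : ι → κ, (B.submatrix f id).det ^ 2 = (Fintype.card ι).factorial * (B.transpose * B).det := by
  classical
  have h1 : ∀ f : ι → κ, (B.submatrix f id).det
      = ∑ σ : Equiv.Perm ι, ((Equiv.Perm.sign σ : ℤ) : R) * ∏ k, B (f k) (σ k) := by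
    intro f
    rw [← Matrix.det_transpose, Matrix.det_apply']
    simp
  -- Letting f range over all functions, not only injective ones, turns the sum of products into a
  -- product of sums.
  have h2 : ∀ σ τ : Equiv.Perm ι,
      ∑ f : ι → κ, (∏ k, B (f k) (σ k)) * ∏ k, B (f k) (τ k)
        = ∏ k, (B.transpose * B) (σ k) (τ k) := by
    intro σ τ
    simp only [Matrix.mul_apply, Matrix.transpose_apply, Finset.prod_univ_sum,
      Fintype.piFinset_univ, Finset.prod_mul_distrib]
  -- For fixed σ this is the determinant with rows permuted by σ, and the two signs of σ cancel;
  -- hence n! equal terms in all.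
  have h3 : ∀ σ : Equiv.Perm ι,
      ∑ τ : Equiv.Perm ι, ((Equiv.Perm.sign σ : ℤ) : R) * ((Equiv.Perm.sign τ : ℤ) : R) *
        ∏ k, (B.transpose * B) (σ k) (τ k) = (B.transpose * B).det := by
    intro σ
    have := Matrix.det_permute σ (B.transpose * B)
    rw [← Matrix.det_transpose, Matrix.det_apply'] at this
    simp only [mul_assoc, ← Finset.mul_sum]
    simp only [Matrix.transpose_apply, Matrix.submatrix_apply, id] at this
    rw [this, ← mul_assoc, ← Int.cast_mul, ← Units.val_mul, Int.units_mul_self]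
    simp
  simp only [h1, sq, Finset.sum_mul_sum]
  rw [Finset.sum_comm]
  have h4 : ∀ σ : Equiv.Perm ι, ∑ f : ι → κ, ∑ τ : Equiv.Perm ι,
      (((Equiv.Perm.sign σ : ℤ) : R) * ∏ k, B (f k) (σ k)) *
      (((Equiv.Perm.sign τ : ℤ) : R) * ∏ k, B (f k) (τ k)) = (B.transpose * B).det := by
    intro σ
    rw [Finset.sum_comm, ← h3 σ]
    refine Finset.sum_congr rfl fun τ _ => ?_
    rw [← h2, Finset.mul_sum]
    exact Finset.sum_congr rfl fun f _ => by ring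
  rw [Finset.sum_congr rfl fun σ _ => h4 σ]
  simp [Fintype.card_perm]

noncomputable section

namespace GraphJacobian

/-! ### Flows, walks and cycles -/

section Graph

variable {V : Type*} (G : SimpleGraph V)

theorem adj_origin_terminus (e : G.edgeSet) : G.Adj (origin G e) (terminus G e) := by
  rw [← SimpleGraph.mem_edgeSet, origin_terminus]
  exact e.2

variable [Fintype V] [DecidableEq V] [DecidableRel G.Adj]

theorem boundary_apply (x : Chain G) (v : V) :
    boundary G x v = ∑ e : G.edgeSet,
      x e * ((if v = terminus G e then 1 else 0) - (if v = origin G e then 1 else 0)) := by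
  simp [boundary, Finset.sum_apply, Pi.single_apply]

theorem boundary_single (e : G.edgeSet) :
    boundary G (EuclideanSpace.single e 1)
      = Pi.single (terminus G e) 1 - Pi.single (origin G e) 1 := by
  simp [boundary, ite_smul]

/-- The sum of the boundary over a vertex set is the flow through the cut. -/
theorem sum_boundary (x : Chain G) (C : Finset V) :
    ∑ v ∈ C, boundary G x v = ∑ e : G.edgeSet,
      x e * ((if terminus G e ∈ C then 1 else 0) - (if origin G e ∈ C then 1 else 0)) := by
  simp only [boundary_apply]
  rw [Finset.sum_comm]
  refine Finset.sum_congr rfl fun e _ => ?_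
  rw [← Finset.mul_sum, Finset.sum_sub_distrib]
  simp

/-- A chain with integer coefficients. -/
def IsIntegral (x : Chain G) : Prop := ∀ e : G.edgeSet, ∃ k : ℤ, x e = k

/-- The chain of a walk. -/
theorem exists_chain_of_walk {u v : V} (p : G.Walk u v) :
    ∃ c : Chain G, IsIntegral G c ∧ boundary G c = Pi.single v 1 - Pi.single u 1 ∧
      ∀ e : G.edgeSet, c e ≠ 0 → (e : Sym2 V) ∈ p.edges := by
  induction p with
  | nil => exact ⟨0, fun e => ⟨0, by simp⟩, by simp, by simp⟩
  | @cons u v w h p ih =>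
    obtain ⟨c, hc, hb, hs⟩ := ih
    let e : G.edgeSet := ⟨s(u, v), h⟩
    have he : s(origin G e, terminus G e) = s(u, v) := origin_terminus G e
    -- The sign k corrects for a chosen orientation opposite to the walk.
    have key : ∃ k : ℤ, boundary G ((k : ℝ) • EuclideanSpace.single e 1)
        = Pi.single v 1 - Pi.single u 1 := by
      rcases Sym2.eq_iff.1 he with ⟨h1, h2⟩ | ⟨h1, h2⟩
      · exact ⟨1, by simp [boundary_single, h1, h2]⟩
      · exact ⟨-1, by rw [map_smul, boundary_single, h1, h2]; simp⟩
    obtain ⟨k, hk⟩ := key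
    refine ⟨(k : ℝ) • EuclideanSpace.single e 1 + c, ?_, ?_, ?_⟩
    · intro e'
      obtain ⟨l, hl⟩ := hc e'
      by_cases h : e' = e
      · exact ⟨k + l, by simp [h, ← hl]⟩
      · exact ⟨l, by simp [h, hl]⟩
    · rw [map_add, hk, hb]; abel
    · intro e' h'
      rw [SimpleGraph.Walk.edges_cons, List.mem_cons]
      by_cases h : e' = e
      · left; rw [h]
      · right; apply hs; simpa [h] using h'

/-- An edge carrying a flow lies on a cycle inside the support of the flow. -/
theorem exists_path_of_flow {x : Chain G} (hx : boundary G x = 0) {e : G.edgeSet} (he : x e ≠ 0) :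
    ∃ p : G.Path (origin G e) (terminus G e),
      ∀ s ∈ p.1.edges, ∃ e' : G.edgeSet, (e' : Sym2 V) = s ∧ e' ≠ e ∧ x e' ≠ 0 := by
  classical
  let H : SimpleGraph V := SimpleGraph.fromEdgeSet {s | ∃ e' : G.edgeSet, e' = s ∧ e' ≠ e ∧ x e' ≠ 0}
  have hH : ∀ s ∈ H.edgeSet, ∃ e' : G.edgeSet, (e' : Sym2 V) = s ∧ e' ≠ e ∧ x e' ≠ 0 := by
    intro s hs
    rw [SimpleGraph.edgeSet_fromEdgeSet] at hs
    exact hs.1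
  have hHG : H ≤ G := by
    rw [← SimpleGraph.edgeSet_subset_edgeSet]
    intro s hs
    obtain ⟨e', rfl, -⟩ := hH s hs
    exact e'.2
  have hr : H.Reachable (origin G e) (terminus G e) := by
    -- Otherwise the component of the origin in the support without `e` is a cut that only `e`
    -- crosses with nonzero flow, contradicting conservation.
    by_contra hr
    have h0 := sum_boundary G x (Finset.univ.filter fun w => H.Reachable (origin G e) w)
    rw [Finset.sum_eq_single e] at h0
    · simp [hx, hr, he] at h0
    · intro e' _ hne
      by_cases h : x e' = 0
      · simp [h]
      · have ha : H.Adj (origin G e') (terminus G e') := by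
          rw [SimpleGraph.fromEdgeSet_adj]
          exact ⟨⟨e', (origin_terminus G e').symm, hne, h⟩, (adj_origin_terminus G e').ne⟩
        have : H.Reachable (origin G e) (origin G e') ↔ H.Reachable (origin G e) (terminus G e') :=
          ⟨fun h => h.trans ha.reachable, fun h => h.trans ha.symm.reachable⟩
        simp [this]
    · simp
  obtain ⟨p⟩ := hr
  refine ⟨⟨(p.toPath : H.Walk _ _).mapLe hHG, ?_⟩, ?_⟩
  · exact (SimpleGraph.Walk.isPath_mapLe hHG).2 p.toPath.2
  · intro s hs
    rw [SimpleGraph.Walk.edges_mapLe_eq_edges] at hs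
    exact hH s (SimpleGraph.Walk.edges_subset_edgeSet _ hs)

/-- An edge carrying a real flow carries an integral flow with value one and no larger support. -/
theorem exists_integral_flow {x : Chain G} (hx : boundary G x = 0) {e : G.edgeSet}
    (he : x e ≠ 0) :
    ∃ y : Chain G, boundary G y = 0 ∧ IsIntegral G y ∧ y e = 1 ∧ ∀ e', x e' = 0 → y e' = 0 := by
  obtain ⟨p, hp⟩ := exists_path_of_flow G hx he
  obtain ⟨c, hc, hb, hs⟩ := exists_chain_of_walk G p.1
  have hs' : ∀ e', c e' ≠ 0 → e' ≠ e ∧ x e' ≠ 0 := by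
    intro e' h
    obtain ⟨e'', h1, h2⟩ := hp _ (hs e' h)
    rwa [Subtype.ext h1] at h2
  -- The edge `e`, closed up by a path back inside the support.
  refine ⟨EuclideanSpace.single e 1 - c, ?_, ?_, ?_, ?_⟩
  · rw [map_sub, hb, boundary_single, sub_self]
  · intro e'
    obtain ⟨l, hl⟩ := hc e'
    by_cases h : e' = e
    · exact ⟨1 - l, by simp [h, ← hl]⟩
    · exact ⟨-l, by simp [h, hl]⟩
  · have : c e = 0 := by
      by_contra h
      exact (hs' e h).1 rfl
    simp [this]
  · intro e' h
    have h1 : c e' = 0 := by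
      by_contra h'
      exact (hs' e' h').2 h
    have h2 : e' ≠ e := by rintro rfl; exact he h
    simp [h1, h2]

/-- The support of a nonzero flow contains a cycle. -/
theorem exists_cycle_of_flow {x : Chain G} (hx : boundary G x = 0) (h0 : x ≠ 0) :
    ∃ (v : V) (w : G.Walk v v), w.IsCycle ∧
      w.length ≤ (Finset.univ.filter fun e : G.edgeSet => x e ≠ 0).card := by
  obtain ⟨e, he⟩ : ∃ e, x e ≠ 0 := by
    by_contra! h
    exact h0 (by ext e; simpa using h e)
  obtain ⟨p, hp⟩ := exists_path_of_flow G hx he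
  have hnot : s(terminus G e, origin G e) ∉ p.1.edges := by
    intro h
    obtain ⟨e', h1, h2, -⟩ := hp _ h
    rw [Sym2.eq_swap, origin_terminus] at h1
    exact h2 (Subtype.ext h1)
  have hcyc := p.cons_isCycle (adj_origin_terminus G e).symm hnot
  refine ⟨_, _, hcyc, ?_⟩
  rw [← SimpleGraph.Walk.length_edges, ← List.toFinset_card_of_nodup hcyc.isTrail.edges_nodup,
    ← Finset.card_map (Function.Embedding.subtype _)]
  refine Finset.card_le_card fun s hs => ?_
  rw [List.mem_toFinset, SimpleGraph.Walk.edges_cons, List.mem_cons] at hs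
  simp only [Finset.mem_map, Finset.mem_filter, Finset.mem_univ, true_and,
    Function.Embedding.subtype_apply]
  rcases hs with rfl | hs
  · exact ⟨e, he, by rw [Sym2.eq_swap, origin_terminus]⟩
  · obtain ⟨e', h1, -, h3⟩ := hp s hs
    exact ⟨e', h3, h1⟩

end Graph

/-! ### Gram determinants and the lattice of integral flows -/

/-- The determinant of a lattice is the Gram determinant of any of its bases. -/
theorem latticeDet_eq_det_gram {E : Type*} [NormedAddCommGroup E] [InnerProductSpace ℝ E]
    [FiniteDimensional ℝ E] [MeasurableSpace E] [BorelSpace E] (L : Submodule ℤ E)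
    [DiscreteTopology L] [IsZLattice ℝ L] (b : Module.Basis (Fin (Module.finrank ℝ E)) ℤ L) :
    latticeDet L = (Matrix.of fun i j => inner ℝ (b i : E) (b j : E)).det := by
  let o := stdOrthonormalBasis ℝ E
  have h1 : (volume : Measure E).real (ZSpan.fundamentalDomain o.toBasis) = 1 := by
    rw [measureReal_congr (ZSpan.fundamentalDomain_ae_parallelepiped o.toBasis volume),
      OrthonormalBasis.coe_toBasis, Measure.real, o.volume_parallelepiped]
    simp
  rw [latticeDet, ZLattice.covolume_eq_det_mul_measureReal L volume b o.toBasis, h1, mul_one,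
    sq_abs, Module.Basis.det_apply, sq]
  nth_rw 1 [← Matrix.det_transpose]
  rw [← Matrix.det_mul]
  congr 1
  ext i j
  simp only [Matrix.mul_apply, Matrix.transpose_apply, Module.Basis.toMatrix_apply,
    Function.comp_apply, OrthonormalBasis.coe_toBasis_repr_apply,
    OrthonormalBasis.repr_apply_apply, Matrix.of_apply]
  rw [← o.sum_inner_mul_inner]
  simp only [real_inner_comm]

section Graph

variable {V : Type*} (G : SimpleGraph V) [Fintype V] [DecidableEq V] [DecidableRel G.Adj]

instance : DiscreteTopology (jacobian G) := by
  apply discreteTopology_of_isOpen_singleton_zero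
  rw [Metric.isOpen_singleton_iff]
  refine ⟨1, one_pos, fun y hy => ?_⟩
  rw [dist_zero_right] at hy
  ext e
  obtain ⟨k, hk⟩ := y.2 e
  have h1 : ‖((y : realHomology G) : Chain G) e‖ < 1 :=
    (PiLp.norm_apply_le ((y : realHomology G) : Chain G) e).trans_lt hy
  rw [hk, Real.norm_eq_abs, ← Int.cast_abs] at h1
  have h2 : |k| < 1 := by exact_mod_cast h1
  rw [hk, Int.abs_lt_one_iff.1 h2]
  simp

/-- Induction on the size of the support: subtracting x(e) times an integral flow through e removes
e and adds no new edge. -/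
theorem mem_span_jacobian (x : realHomology G) :
    x ∈ Submodule.span ℝ (jacobian G : Set (realHomology G)) := by
  classical
  induction hn : (Finset.univ.filter fun e : G.edgeSet => (x : Chain G) e ≠ 0).card using
    Nat.strong_induction_on generalizing x with
  | _ n ih =>
    by_cases h0 : ∃ e, (x : Chain G) e ≠ 0
    · obtain ⟨e, he⟩ := h0
      obtain ⟨y, hy, hyi, hye, hys⟩ := exists_integral_flow G x.2 he
      let z : realHomology G := ⟨y, hy⟩
      have hz : z ∈ Submodule.span ℝ (jacobian G : Set (realHomology G)) :=
        Submodule.subset_span hyi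
      have hlt : (Finset.univ.filter fun e' : G.edgeSet =>
          ((x - (x : Chain G) e • z : realHomology G) : Chain G) e' ≠ 0).card < n := by
        rw [← hn]
        apply Finset.card_lt_card
        rw [Finset.ssubset_iff_of_subset]
        · refine ⟨e, by simp [he], fun h => (Finset.mem_filter.1 h).2 ?_⟩
          simp [z, hye]
        · intro e'
          simp only [Finset.mem_filter, Finset.mem_univ, true_and]
          intro h h'
          apply h
          simp [z, h', hys e' h']
      have := ih _ hlt (x - (x : Chain G) e • z) rfl
      simpa using Submodule.add_mem _ this (Submodule.smul_mem _ ((x : Chain G) e) hz)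
    · push Not at h0
      have : x = 0 := by ext e; simpa using h0 e
      rw [this]
      exact Submodule.zero_mem _

instance : IsZLattice ℝ (jacobian G) :=
  ⟨eq_top_iff.2 fun x _ => mem_span_jacobian G x⟩

theorem finrank_jacobian : Module.finrank ℤ (jacobian G) = betti G :=
  ZLattice.rank ℝ (jacobian G)

instance : Module.Free ℤ (jacobian G) := ZLattice.module_free ℝ (jacobian G)

instance : Module.Finite ℤ (jacobian G) := ZLattice.module_finite ℝ (jacobian G)

/-- A `ℤ`-basis of the Jacobian. -/
def jacobianBasis : Module.Basis (Fin (betti G)) ℤ (jacobian G) :=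
  Module.finBasisOfFinrankEq ℤ _ (finrank_jacobian G)

/-- The matrix of the cycles of a basis of the Jacobian. -/
def cycleMatrix : Matrix G.edgeSet (Fin (betti G)) ℝ :=
  Matrix.of fun e i => ((jacobianBasis G i : realHomology G) : Chain G) e

theorem latticeDet_jacobian :
    latticeDet (jacobian G) = ((cycleMatrix G).transpose * cycleMatrix G).det := by
  have h : ∀ x y : realHomology G,
      inner ℝ x y = ∑ e, (x : Chain G) e * (y : Chain G) e := by
    intro x y
    rw [Submodule.coe_inner, PiLp.inner_apply]
    exact Finset.sum_congr rfl fun e _ => mul_comm _ _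
  refine (latticeDet_eq_det_gram (jacobian G) (jacobianBasis G)).trans
    (congrArg Matrix.det (Matrix.ext fun i j => ?_))
  exact h _ _

theorem jacobian_apply (z : jacobian G) (e : G.edgeSet) :
    ((z : realHomology G) : Chain G) e
      = ∑ k, ((jacobianBasis G).repr z k : ℝ) * cycleMatrix G e k := by
  have h : ((z : realHomology G) : Chain G) = (((∑ k, (jacobianBasis G).repr z k •
      jacobianBasis G k : jacobian G) : realHomology G) : Chain G) := by
    rw [(jacobianBasis G).sum_repr z]
  rw [h]
  simp [cycleMatrix, -Module.Basis.sum_repr]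

/-- The maximal minors of the cycle matrix are `0` or `±1`. -/
theorem det_cycleMatrix_sq_le (f : Fin (betti G) → G.edgeSet) :
    ((cycleMatrix G).submatrix f id).det ^ 2 ≤ 1 := by
  set M := (cycleMatrix G).submatrix f id with hM
  by_cases hdet : M.det = 0
  · simp [hdet]
  have hunit : IsUnit M.det := isUnit_iff_ne_zero.2 hdet
  have hint : ∀ i j, ∃ k : ℤ, M i j = k := fun i j => (jacobianBasis G j).2 (f i)
  choose A hA using hint
  have hMA : M = (Matrix.of A).map (Int.cast : ℤ → ℝ) := by
    ext i j
    simp [hA]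
  -- Column i of M⁻¹ gives a real flow equal to δ on the chosen edges. An integral flow within its
  -- support and equal to 1 at `f i` has the same values there, so its integer coordinates provide
  -- an integral inverse column.
  have key : ∀ i, ∃ n : Fin (betti G) → ℤ, ∀ j, ∑ k, A j k * n k = if j = i then 1 else 0 := by
    intro i
    let x : realHomology G := ∑ k, M⁻¹ k i • (jacobianBasis G k : realHomology G)
    have hx : ∀ j, (x : Chain G) (f j) = if j = i then 1 else 0 := by
      intro j
      have := congrFun (congrFun (Matrix.mul_nonsing_inv M hunit) j) i
      rw [Matrix.one_apply] at this
      rw [← this]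
      rw [Matrix.mul_apply]
      simp only [x, AddSubmonoidClass.coe_finsetSum, WithLp.ofLp_sum, Finset.sum_apply,
        Submodule.coe_smul, PiLp.smul_apply, smul_eq_mul]
      exact Finset.sum_congr rfl fun k _ => mul_comm _ _
    have hxi : (x : Chain G) (f i) ≠ 0 := by simp [hx]
    obtain ⟨y, hy, hyi, hye, hys⟩ := exists_integral_flow G x.2 hxi
    let z : jacobian G := ⟨⟨y, hy⟩, hyi⟩
    refine ⟨fun k => (jacobianBasis G).repr z k, fun j => ?_⟩
    have h1 : y (f j) = if j = i then 1 else 0 := by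
      split_ifs with h
      · rw [h, hye]
      · exact hys _ (by simp [hx, h])
    have h2 : y (f j) = ∑ k, (A j k : ℝ) * ((jacobianBasis G).repr z k : ℝ) := by
      refine (jacobian_apply G z (f j)).trans (Finset.sum_congr rfl fun k _ => ?_)
      rw [mul_comm, ← hA]
      rfl
    rw [h1] at h2
    have h5 : ((∑ k, A j k * (jacobianBasis G).repr z k : ℤ) : ℝ)
        = ((if j = i then 1 else 0 : ℤ) : ℝ) := by
      push_cast
      exact h2.symm
    exact_mod_cast h5
  choose N hN using key
  have hAN : Matrix.of A * (Matrix.of N).transpose = 1 := by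
    ext j i
    simpa [Matrix.mul_apply, Matrix.one_apply] using hN i j
  have hu : IsUnit (Matrix.of A).det := (Matrix.isUnit_iff_isUnit_det _).1
    (IsUnit.of_mul_eq_one _ hAN)
  have hd : M.det = ((Matrix.of A).det : ℝ) := by
    rw [hMA]
    exact (Int.cast_det _).symm
  rw [hd]
  rcases Int.isUnit_iff.1 hu with h | h <;> simp [h]

omit [DecidableEq V] in
theorem finrank_chain : Module.finrank ℝ (Chain G) = Fintype.card G.edgeSet :=
  finrank_euclideanSpace

theorem betti_le_card_edgeSet : betti G ≤ Fintype.card G.edgeSet := by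
  rw [← finrank_chain]
  exact Submodule.finrank_le _

omit [DecidableEq V] in
theorem card_edgeSet_of_regular (h : G.IsRegularOfDegree 3) :
    2 * Fintype.card G.edgeSet = 3 * Fintype.card V := by
  have := G.sum_degrees_eq_twice_card_edges
  rw [Finset.sum_congr rfl fun v _ => h.degree_eq v, SimpleGraph.edgeFinset_card] at this
  rw [← this, Finset.sum_const, Finset.card_univ, smul_eq_mul, mul_comm]

/-- Rank–nullity gives b ≥ |E| - |V|, and |V| = 2|E|/3. -/
theorem card_edgeSet_le_of_regular (h : G.IsRegularOfDegree 3) :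
    Fintype.card G.edgeSet ≤ 3 * betti G := by
  have h1 := card_edgeSet_of_regular G h
  have h2 := LinearMap.finrank_range_add_finrank_ker (boundary G)
  rw [finrank_chain] at h2
  have h3 := Submodule.finrank_le (LinearMap.range (boundary G))
  rw [Module.finrank_pi] at h3
  change _ + betti G = _ at h2
  omega

theorem latticeDet_jacobian_le (h : G.IsRegularOfDegree 3) :
    latticeDet (jacobian G) ≤ (3 * Real.exp 1) ^ betti G := by
  have h1 := Matrix.sum_det_submatrix_sq (cycleMatrix G)
  rw [← latticeDet_jacobian, Fintype.card_fin] at h1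
  have h2 : ∑ f : Fin (betti G) → G.edgeSet, ((cycleMatrix G).submatrix f id).det ^ 2
      ≤ (Fintype.card G.edgeSet : ℝ) ^ betti G := by
    refine (Finset.sum_le_sum fun f _ => det_cycleMatrix_sq_le G f).trans ?_
    simp
  have h3 : (Fintype.card G.edgeSet : ℝ) ≤ 3 * betti G := by
    exact_mod_cast card_edgeSet_le_of_regular G h
  have h4 : (betti G : ℝ) ^ betti G / (betti G).factorial ≤ Real.exp (betti G) :=
    Real.pow_div_factorial_le_exp _ (by positivity) _
  have h5 : (0 : ℝ) < (betti G).factorial := by positivity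
  rw [div_le_iff₀ h5, ← Real.exp_one_pow] at h4
  have h6 : ((betti G).factorial : ℝ) * latticeDet (jacobian G)
      ≤ (betti G).factorial * (3 * Real.exp 1) ^ betti G := by
    rw [← h1]
    calc _ ≤ (Fintype.card G.edgeSet : ℝ) ^ betti G := h2
      _ ≤ (3 * betti G : ℝ) ^ betti G := by gcongr
      _ = 3 ^ betti G * (betti G : ℝ) ^ betti G := mul_pow _ _ _
      _ ≤ 3 ^ betti G * (Real.exp 1 ^ betti G * (betti G).factorial) := by gcongr
      _ = _ := by rw [mul_pow]; ring
  exact le_of_mul_le_mul_left h6 h5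

theorem latticeDet_jacobian_pos : 0 < latticeDet (jacobian G) :=
  pow_pos (ZLattice.covolume_pos _ _) 2

theorem girth_le_minNorm (hb : 0 < betti G) : (G.girth : ℝ) ≤ minNorm (jacobian G) := by
  apply le_csInf
  · refine ⟨_, jacobianBasis G ⟨0, hb⟩, (jacobianBasis G ⟨0, hb⟩).2, ?_, rfl⟩
    simpa using (jacobianBasis G).ne_zero ⟨0, hb⟩
  · rintro r ⟨x, hx, h0, rfl⟩
    obtain ⟨v, w, hw, hl⟩ := exists_cycle_of_flow G x.2 (by simpa using h0)
    have h1 : G.girth ≤ (Finset.univ.filter fun e : G.edgeSet => (x : Chain G) e ≠ 0).card :=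
      (SimpleGraph.girth_le_length hw).trans hl
    refine (Nat.cast_le.2 h1).trans ?_
    rw [Submodule.coe_inner, PiLp.inner_apply, Finset.card_filter]
    push_cast
    refine Finset.sum_le_sum fun e _ => ?_
    obtain ⟨k, hk⟩ := hx e
    rw [hk]
    -- Each edge of the support contributes k² ≥ 1.
    by_cases hk0 : k = 0
    · simp [hk0]
    · have : (1 : ℤ) ≤ k * k := by
        have := mul_self_pos.2 hk0
        omega
      have h2 : (1 : ℝ) ≤ k * k := by exact_mod_cast this
      rw [if_pos (by exact_mod_cast hk0)]
      exact h2

theorem exists_cycle_of_betti_pos (hb : 0 < betti G) :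
    ∃ (v : V) (w : G.Walk v v), w.IsCycle ∧ w.length ≤ Fintype.card G.edgeSet := by
  have h0 : (jacobianBasis G ⟨0, hb⟩ : realHomology G) ≠ 0 := by
    simpa using (jacobianBasis G).ne_zero ⟨0, hb⟩
  obtain ⟨v, w, hw, hl⟩ := exists_cycle_of_flow G
    (jacobianBasis G ⟨0, hb⟩ : realHomology G).2 (by simpa using h0)
  exact ⟨v, w, hw, hl.trans (Finset.card_le_univ _)⟩

/-- The girth controls the Hermite invariant of the Jacobian of a cubic graph. -/
theorem girth_div_le_hermiteInvariant (h : G.IsRegularOfDegree 3) (hb : 0 < betti G) :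
    (G.girth : ℝ) / (3 * Real.exp 1) ≤ hermiteInvariant (jacobian G) := by
  have h1 := girth_le_minNorm G hb
  have hpos := latticeDet_jacobian_pos G
  have h2 : latticeDet (jacobian G) ^ (1 / (betti G : ℝ)) ≤ 3 * Real.exp 1 := by
    have h3 := Real.rpow_le_rpow hpos.le (latticeDet_jacobian_le G h)
      (by positivity : 0 ≤ 1 / (betti G : ℝ))
    rwa [one_div, Real.pow_rpow_inv_natCast (by positivity) hb.ne', ← one_div] at h3
  exact div_le_div₀ ((Nat.cast_nonneg _).trans h1) h1 (Real.rpow_pos_of_pos hpos _) h2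

end Graph

/-- Large girth of cubic graphs forces a large Hermite invariant. -/
theorem IsLargeGirthCubicFamily.hermiteInvariant_asympGE {V : ℕ → Type*} [∀ m, Fintype (V m)]
    [∀ m, DecidableEq (V m)] {G : ∀ m, SimpleGraph (V m)} [∀ m, DecidableRel (G m).Adj]
    (hG : IsLargeGirthCubicFamily G) :
    AsympGE (fun m => hermiteInvariant (jacobian (G m)))
      (fun m => 4 / (9 * Real.exp 1) * Real.logb 2 (betti (G m) : ℝ)) := by
  intro ε hε
  filter_upwards [hG.girth ε hε, hG.betti_tendsto.eventually_gt_atTop 0] with m h1 h2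
  refine le_trans ?_ (girth_div_le_hermiteInvariant (G m) (hG.regular m) h2)
  rw [le_div_iff₀ (by positivity)]
  refine le_of_eq_of_le ?_ h1
  field_simp
  ring

/-! ### A definite quaternion order unramified at two -/

section Quaternion

open scoped Quaternion

/-- The quaternion algebra with `i² = i - 1`, `j² = -1`. Over `ℤ` it is an order in the
definite rational quaternion algebra of discriminant three. -/
abbrev EisensteinQuaternion (R : Type*) [CommRing R] : Type _ := ℍ[R, (-1 : R), (1 : R), (-1 : R)]

/-- Coefficientwise reduction of integral quaternions. -/
def reduceTo (R : Type*) [CommRing R] : EisensteinQuaternion ℤ →+* EisensteinQuaternion R where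
  toFun x := ⟨x.re, x.imI, x.imJ, x.imK⟩
  map_one' := by ext <;> simp
  map_zero' := by ext <;> simp
  map_add' x y := by ext <;> simp
  map_mul' x y := by ext <;> simp

/-- The reduced norm. -/
def reducedNorm (x : EisensteinQuaternion ℤ) : ℤ :=
  x.re ^ 2 + x.re * x.imI + x.imI ^ 2 + x.imJ ^ 2 + x.imJ * x.imK + x.imK ^ 2

theorem reducedNorm_mul (x y : EisensteinQuaternion ℤ) :
    reducedNorm (x * y) = reducedNorm x * reducedNorm y := by
  simp only [reducedNorm, QuaternionAlgebra.re_mul, QuaternionAlgebra.imI_mul,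
    QuaternionAlgebra.imJ_mul, QuaternionAlgebra.imK_mul]
  ring

/-- Three quaternions `1 + ω ^ a j` of norm two, and their conjugates. -/
def letter (b : Bool) (a : Fin 3) : EisensteinQuaternion ℤ :=
  ⟨1, 0, (if b then -1 else 1) * ![1, -1, 0] a, (if b then -1 else 1) * ![0, 1, -1] a⟩

theorem letter_mul_letter_not (b : Bool) (a : Fin 3) : letter b a * letter (!b) a = 2 := by
  fin_cases a <;> cases b <;> ext <;> simp [letter] <;> rfl

theorem reducedNorm_letter (b : Bool) (a : Fin 3) : reducedNorm (letter b a) = 2 := by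
  fin_cases a <;> cases b <;> simp [letter, reducedNorm]

/-- Signs vanish modulo two, so a letter and its conjugate have the same reduction. -/
theorem reduceTo_two_letter (b : Bool) (a : Fin 3) :
    reduceTo (ZMod 2) (letter b a) = ⟨1, 0, ![1, 1, 0] a, ![0, 1, 1] a⟩ := by
  fin_cases a <;> cases b <;> ext <;> simp [letter, reduceTo]

/-- Modulo two, a left multiple of a letter is annihilated on the right by no other letter. -/
theorem mul_letter_mul_letter_ne_zero {w : EisensteinQuaternion ℤ} {b b' : Bool} {a a' : Fin 3}
    (haa : a ≠ a') (h : reduceTo (ZMod 2) (w * letter b a) ≠ 0) :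
    reduceTo (ZMod 2) (w * letter b a * letter b' a') ≠ 0 := by
  rw [map_mul] at h
  rw [map_mul, map_mul]
  rw [reduceTo_two_letter] at h ⊢
  rw [reduceTo_two_letter]
  generalize reduceTo (ZMod 2) w = v at h ⊢
  obtain ⟨x, y, z, t⟩ := v
  simp only [QuaternionAlgebra.mk_mul_mk, ne_eq, QuaternionAlgebra.ext_iff,
    QuaternionAlgebra.re_zero, QuaternionAlgebra.imI_zero, QuaternionAlgebra.imJ_zero,
    QuaternionAlgebra.imK_zero] at h ⊢
  -- Finite check. Conceptually, the algebra is M₂(𝔽₂) and the letters are its three nonzero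
  -- nilpotents, whose kernels are distinct lines.
  revert x y z t a a'
  decide

theorem reduceTo_letter_ne_zero (b : Bool) (a : Fin 3) : reduceTo (ZMod 2) (letter b a) ≠ 0 := by
  rw [reduceTo_two_letter]
  intro h
  simpa using congrArg QuaternionAlgebra.re h

/-- With P = 2^k, q² divides (2P - (2x+y))(2P + (2x+y)) while q cannot divide both factors; so q²
divides one of them, and each lies between 0 and 4P. -/
theorem pow_four_le_of_scalar_mod {q : ℕ} (hq : q.Prime) (hq2 : q ≠ 2) {w : EisensteinQuaternion ℤ}
    {k : ℕ} (hk : 0 < k) (hw : reducedNorm w = 2 ^ (2 * k)) (hw2 : reduceTo (ZMod 2) w ≠ 0)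
    (hI : (q : ℤ) ∣ w.imI) (hJ : (q : ℤ) ∣ w.imJ) (hK : (q : ℤ) ∣ w.imK) :
    q ^ 4 ≤ 2 ^ (2 * k + 4) := by
  obtain ⟨x, y, z, t⟩ := w
  simp only [reducedNorm] at hw hI hJ hK
  have hqZ : Prime (q : ℤ) := Nat.prime_iff_prime_int.1 hq
  have hP : (2 : ℤ) ^ (2 * k) = 2 ^ k * 2 ^ k := by rw [two_mul, pow_add]
  set P : ℤ := 2 ^ k with hPdef
  have hPpos : 0 < P := by positivity
  rw [hP] at hw
  -- Four times the norm equation, with squares completed.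
  have hfac : (2 * P - (2 * x + y)) * (2 * P + (2 * x + y))
      = 3 * y ^ 2 + (2 * z + t) ^ 2 + 3 * t ^ 2 := by linear_combination (-4) * hw
  have hdvd : (q : ℤ) ^ 2 ∣ (2 * P - (2 * x + y)) * (2 * P + (2 * x + y)) := by
    rw [hfac]
    obtain ⟨y', rfl⟩ := hI
    obtain ⟨z', rfl⟩ := hJ
    obtain ⟨t', rfl⟩ := hK
    exact ⟨3 * y' ^ 2 + (2 * z' + t') ^ 2 + 3 * t' ^ 2, by ring⟩
  have hnot : ¬ ((q : ℤ) ∣ 2 * P - (2 * x + y) ∧ (q : ℤ) ∣ 2 * P + (2 * x + y)) := by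
    rintro ⟨h1, h2⟩
    have h3 : (q : ℤ) ∣ 2 ^ (k + 2) := by
      have := dvd_add h1 h2
      have h4 : (2 * P - (2 * x + y)) + (2 * P + (2 * x + y)) = 2 ^ (k + 2) := by
        rw [pow_add, ← hPdef]; ring
      rwa [h4] at this
    have h5 : (q : ℤ) ∣ 2 := hqZ.dvd_of_dvd_pow h3
    have h6 : q ∣ 2 := by exact_mod_cast h5
    exact hq2 ((Nat.prime_dvd_prime_iff_eq hq Nat.prime_two).1 h6)
  -- A zero product forces w = ±2^k, which vanishes modulo two since k > 0.
  have hne : (2 * P - (2 * x + y)) * (2 * P + (2 * x + y)) ≠ 0 := by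
    intro h0
    rw [h0] at hfac
    have ht : t = 0 := by nlinarith [sq_nonneg y, sq_nonneg (2 * z + t), sq_nonneg t]
    have hy : y = 0 := by nlinarith [sq_nonneg y, sq_nonneg (2 * z + t), sq_nonneg t]
    have hz : z = 0 := by
      subst ht hy
      nlinarith [sq_nonneg z]
    subst ht hy hz
    have hPx : (2 : ℤ) ∣ x := by
      have h2P : (2 : ℤ) ∣ P := dvd_pow_self 2 hk.ne'
      have : (2 : ℤ) ∣ x ^ 2 := by
        have : x ^ 2 = P * P := by linarith
        rw [this]
        exact h2P.mul_right _
      exact Int.prime_two.dvd_of_dvd_pow this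
    apply hw2
    have hx0 : ((x : ℤ) : ZMod 2) = 0 := (ZMod.intCast_zmod_eq_zero_iff_dvd x 2).2 hPx
    ext <;> simp [reduceTo, hx0]
  have hpos : 0 ≤ (2 * P - (2 * x + y)) * (2 * P + (2 * x + y)) := by
    rw [hfac]; positivity
  obtain ⟨hlo, hhi⟩ := abs_le.1 <| abs_le_of_sq_le_sq (show (2 * x + y) ^ 2 ≤ (2 * P) ^ 2 by linarith) (by positivity)
  have hbound : (q : ℤ) ^ 2 ≤ 4 * P := by
    by_cases h1 : (q : ℤ) ∣ 2 * P - (2 * x + y)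
    · have h2 : ¬ (q : ℤ) ∣ 2 * P + (2 * x + y) := fun h => hnot ⟨h1, h⟩
      have h3 : (q : ℤ) ^ 2 ∣ 2 * P - (2 * x + y) := hqZ.pow_dvd_of_dvd_mul_right 2 h2 hdvd
      have := Int.le_of_dvd (lt_of_le_of_ne (by linarith) (left_ne_zero_of_mul hne).symm) h3
      linarith
    · have h3 : (q : ℤ) ^ 2 ∣ 2 * P + (2 * x + y) := hqZ.pow_dvd_of_dvd_mul_left 2 h1 hdvd
      have := Int.le_of_dvd (lt_of_le_of_ne (by linarith) (right_ne_zero_of_mul hne).symm) h3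
      linarith
  have hfin : (q : ℤ) ^ 4 ≤ 2 ^ (2 * k + 4) := by
    calc (q : ℤ) ^ 4 = ((q : ℤ) ^ 2) ^ 2 := by ring
      _ ≤ (4 * P) ^ 2 := by gcongr
      _ = 2 ^ (2 * k + 4) := by rw [pow_add, hP]; ring
  exact_mod_cast hfin

end Quaternion

/-! ### The projective unit group modulo a prime -/

section ProjectiveGroup

variable (q : ℕ) [Fact q.Prime]

/-- The scalar units of the quaternions modulo `q`. -/
def scalarUnits : Subgroup (EisensteinQuaternion (ZMod q))ˣ :=
  (Units.map (algebraMap (ZMod q) (EisensteinQuaternion (ZMod q))).toMonoidHom).range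

theorem mem_scalarUnits {U : (EisensteinQuaternion (ZMod q))ˣ} :
    U ∈ scalarUnits q ↔ ∃ c : (ZMod q)ˣ,
      algebraMap (ZMod q) (EisensteinQuaternion (ZMod q)) c = U := by
  simp [scalarUnits, MonoidHom.mem_range, Units.ext_iff]

instance : (scalarUnits q).Normal where
  conj_mem n hn g := by
    obtain ⟨c, hc⟩ := (mem_scalarUnits q).1 hn
    refine (mem_scalarUnits q).2 ⟨c, ?_⟩
    rw [Units.val_mul, Units.val_mul, ← hc, ← Algebra.commutes, mul_assoc, Units.mul_inv, mul_one]

/-- The group of units of the quaternions modulo `q`, up to scalars. -/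
abbrev ProjectiveUnits : Type := (EisensteinQuaternion (ZMod q))ˣ ⧸ scalarUnits q

instance : Finite (EisensteinQuaternion (ZMod q)) :=
  Finite.of_equiv _ (QuaternionAlgebra.equivTuple (-1 : ZMod q) 1 (-1)).symm

theorem card_projectiveUnits_le : Nat.card (ProjectiveUnits q) ≤ 2 * q ^ 3 := by
  have hq : q.Prime := Fact.out
  have h1 := (scalarUnits q).card_eq_card_quotient_mul_card_subgroup
  have h2 : Nat.card (scalarUnits q) = q - 1 := by
    have hinj : Function.Injective
        (Units.map (algebraMap (ZMod q) (EisensteinQuaternion (ZMod q))).toMonoidHom) :=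
      Units.map_injective QuaternionAlgebra.algebraMap_injective
    rw [scalarUnits, ← Nat.card_congr (MonoidHom.ofInjective hinj).toEquiv,
      Nat.card_eq_fintype_card, ZMod.card_units]
  have h3 : Nat.card (EisensteinQuaternion (ZMod q))ˣ ≤ q ^ 4 := by
    refine (Nat.card_le_card_of_injective _ Units.val_injective).trans ?_
    rw [Nat.card_congr (QuaternionAlgebra.equivTuple (-1 : ZMod q) 1 (-1))]
    simp
  rw [h2] at h1
  obtain ⟨r, hr⟩ : ∃ r, q = r + 2 := ⟨q - 2, by have := hq.two_le; omega⟩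
  have h4 : Nat.card (ProjectiveUnits q) * q ≤ 2 * q ^ 3 * q := by
    calc Nat.card (ProjectiveUnits q) * q ≤ Nat.card (ProjectiveUnits q) * (2 * (q - 1)) := by
          -- The factor 2 comes from q ≤ 2(q - 1); it is harmless after taking logarithms.
          gcongr; omega
      _ = 2 * Nat.card (EisensteinQuaternion (ZMod q))ˣ := by rw [h1]; ring
      _ ≤ 2 * q ^ 4 := by gcongr
      _ = 2 * q ^ 3 * q := by ring
  exact Nat.le_of_mul_le_mul_right h4 hq.pos

theorem two_ne_zero_zmod (hq2 : q ≠ 2) : (2 : ZMod q) ≠ 0 := by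
  intro h
  have : ((2 : ℕ) : ZMod q) = 0 := by exact_mod_cast h
  rw [ZMod.natCast_eq_zero_iff] at this
  exact hq2 ((Nat.prime_dvd_prime_iff_eq Fact.out Nat.prime_two).1 this)

theorem reduceTo_two : reduceTo (ZMod q) 2 = algebraMap (ZMod q) _ 2 := by
  rw [map_ofNat, map_ofNat]

/-- A letter as a unit modulo an odd prime. -/
def letterUnit (hq2 : q ≠ 2) (b : Bool) (a : Fin 3) : (EisensteinQuaternion (ZMod q))ˣ where
  val := reduceTo (ZMod q) (letter b a)
  inv := (2 : ZMod q)⁻¹ • reduceTo (ZMod q) (letter (!b) a)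
  val_inv := by
    rw [mul_smul_comm, ← map_mul, letter_mul_letter_not, reduceTo_two, Algebra.algebraMap_eq_smul_one,
      smul_smul, inv_mul_cancel₀ (two_ne_zero_zmod q hq2), one_smul]
  inv_val := by
    have h := letter_mul_letter_not (!b) a
    rw [Bool.not_not] at h
    rw [smul_mul_assoc, ← map_mul, h, reduceTo_two, Algebra.algebraMap_eq_smul_one,
      smul_smul, inv_mul_cancel₀ (two_ne_zero_zmod q hq2), one_smul]

/-- The class of a letter in the projective unit group. -/
def letterClass (hq2 : q ≠ 2) (b : Bool) (a : Fin 3) : ProjectiveUnits q :=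
  QuotientGroup.mk (letterUnit q hq2 b a)

theorem letterClass_mul_letterClass_not (hq2 : q ≠ 2) (b : Bool) (a : Fin 3) :
    letterClass q hq2 b a * letterClass q hq2 (!b) a = 1 := by
  rw [letterClass, letterClass, ← QuotientGroup.mk_mul, QuotientGroup.eq_one_iff,
    mem_scalarUnits]
  refine ⟨Units.mk0 2 (two_ne_zero_zmod q hq2), ?_⟩
  rw [Units.val_mul, Units.val_mk0]
  simp only [letterUnit]
  rw [← map_mul, letter_mul_letter_not, reduceTo_two]

theorem letterClass_injective (hq2 : q ≠ 2) (b : Bool) :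
    Function.Injective (letterClass q hq2 b) := by
  intro a a' h
  rw [letterClass, letterClass, QuotientGroup.eq, mem_scalarUnits] at h
  obtain ⟨c, hc⟩ := h
  rw [Units.val_mul, Units.eq_inv_mul_iff_mul_eq] at hc
  simp only [letterUnit, QuaternionAlgebra.algebraMap_eq, reduceTo, RingHom.coe_mk,
    MonoidHom.coe_mk, OneHom.coe_mk, QuaternionAlgebra.mk_mul_mk, QuaternionAlgebra.ext_iff] at hc
  obtain ⟨h1, -, h3, h4⟩ := hc
  -- Every letter has real part 1, so the scalar must be 1.
  have hc1 : (c : ZMod q) = 1 := by simpa [letter] using h1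
  rw [hc1] at h3 h4
  fin_cases a <;> fin_cases a' <;> cases b <;> simp [letter] at h3 h4 ⊢

end ProjectiveGroup

/-! ### Cubic graphs of large girth -/

section CubicGraph

variable (q : ℕ) [Fact q.Prime] (hq2 : q ≠ 2)

/-- The bipartite graph on two copies of the projective unit group in which the neighbours are
given by right multiplication with the letters. -/
def quaternionGraph : SimpleGraph (ProjectiveUnits q × Bool) where
  -- The Boolean switches between letters and conjugates, so reversing an edge multiplies by the
  -- inverse class.
  Adj x y := y.2 = !x.2 ∧ ∃ a, y.1 = x.1 * letterClass q hq2 x.2 a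
  symm := ⟨by
    rintro ⟨g, b⟩ ⟨h, c⟩ ⟨h1, a, h2⟩
    simp only at h1 h2
    subst h1 h2
    exact ⟨by simp, a, by rw [mul_assoc, letterClass_mul_letterClass_not, mul_one]⟩⟩
  loopless := ⟨by
    rintro ⟨g, b⟩ ⟨h, -⟩
    simp at h⟩

theorem ncard_neighborSet_quaternionGraph (x : ProjectiveUnits q × Bool) :
    ((quaternionGraph q hq2).neighborSet x).ncard = 3 := by
  have h : (quaternionGraph q hq2).neighborSet x
      = Set.range fun a : Fin 3 => (x.1 * letterClass q hq2 x.2 a, !x.2) := by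
    ext ⟨h, c⟩
    simp only [SimpleGraph.mem_neighborSet, quaternionGraph, Set.mem_range, Prod.mk.injEq]
    constructor
    · rintro ⟨h1, a, h2⟩
      exact ⟨a, h2.symm, h1.symm⟩
    · rintro ⟨a, h2, h1⟩
      exact ⟨h1.symm, a, h2.symm⟩
  rw [h, ← Set.image_univ, Set.ncard_image_of_injective]
  · simp
  · intro a a' h
    exact letterClass_injective q hq2 x.2 (mul_left_cancel (Prod.ext_iff.1 h).1)

/-- A walk without backtracking is described by an integral quaternion that is primitive at two. -/
theorem exists_word {L : ℕ} {f : ℕ → ProjectiveUnits q × Bool}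
    (hadj : ∀ i < L, (quaternionGraph q hq2).Adj (f i) (f (i + 1)))
    (hne : ∀ i, i + 2 ≤ L → f i ≠ f (i + 2)) (i : ℕ) (hi : i < L) :
    -- The last letter stays a separate factor because primitivity of the next product depends on
    -- it.
    ∃ (w : EisensteinQuaternion ℤ) (a : Fin 3) (U : (EisensteinQuaternion (ZMod q))ˣ),
      reduceTo (ZMod 2) (w * letter (f i).2 a) ≠ 0 ∧
      reducedNorm (w * letter (f i).2 a) = 2 ^ (i + 1) ∧
      (f (i + 1)).1 = (f i).1 * letterClass q hq2 (f i).2 a ∧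
      (U : EisensteinQuaternion (ZMod q)) = reduceTo (ZMod q) (w * letter (f i).2 a) ∧
      (f (i + 1)).1 = (f 0).1 * QuotientGroup.mk U := by
  induction i with
  | zero =>
    obtain ⟨-, a, ha⟩ := hadj 0 hi
    refine ⟨1, a, letterUnit q hq2 (f 0).2 a, ?_, ?_, ha, ?_, ha⟩
    · rw [one_mul]
      exact reduceTo_letter_ne_zero _ _
    · rw [one_mul, reducedNorm_letter]
      norm_num
    · rw [one_mul]
      rfl
  | succ i ih =>
    obtain ⟨w, a, U, h1, h2, h3, h4, h5⟩ := ih (by omega)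
    obtain ⟨hs, -⟩ := hadj i (by omega)
    obtain ⟨hs', a', ha'⟩ := hadj (i + 1) hi
    -- Repeating the index multiplies by a letter and its conjugate, a scalar, so the walk would
    -- backtrack.
    have haa : a ≠ a' := by
      rintro rfl
      apply hne i (by omega)
      refine Prod.ext ?_ ?_
      · rw [ha', h3, hs, mul_assoc, letterClass_mul_letterClass_not, mul_one]
      · rw [hs', hs, Bool.not_not]
    refine ⟨w * letter (f i).2 a, a', U * letterUnit q hq2 (f (i + 1)).2 a',
      mul_letter_mul_letter_ne_zero haa h1, ?_, ha', ?_, ?_⟩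
    · rw [reducedNorm_mul, h2, reducedNorm_letter, pow_succ _ (i + 1)]
    · rw [Units.val_mul, h4, map_mul _ (w * letter (f i).2 a)]
      rfl
    · rw [ha', h5, mul_assoc, QuotientGroup.mk_mul]
      rfl

theorem even_length_quaternionGraph {x : ProjectiveUnits q × Bool}
    (p : (quaternionGraph q hq2).Walk x x) : Even p.length := by
  have h : ∀ {x y} (p : (quaternionGraph q hq2).Walk x y), (x.2 = y.2 ↔ Even p.length) := by
    intro x y p
    induction p with
    | nil => simp
    | @cons u v w h p ih =>
      rw [SimpleGraph.Walk.length_cons, Nat.even_add_one, ← ih, h.1]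
      cases u.2 <;> cases w.2 <;> simp
  exact (h p).1 rfl

theorem pow_four_le_of_isCycle {x : ProjectiveUnits q × Bool}
    {p : (quaternionGraph q hq2).Walk x x} (hp : p.IsCycle) : q ^ 4 ≤ 2 ^ (p.length + 4) := by
  have h3 := hp.three_le_length
  have hadj : ∀ i < p.length, (quaternionGraph q hq2).Adj (p.getVert i) (p.getVert (i + 1)) :=
    fun i hi => p.adj_getVert_succ hi
  have hne : ∀ i, i + 2 ≤ p.length → p.getVert i ≠ p.getVert (i + 2) := by
    intro i hi h
    -- Vertices of a cycle are distinct only for indices 1 to the length, so index 0 is replaced by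
    -- the length.
    rcases Nat.eq_zero_or_pos i with rfl | hi0
    · have h : p.getVert p.length = p.getVert (0 + 2) := by
        rw [← h, p.getVert_zero, p.getVert_length]
      have := hp.getVert_injOn (x₁ := p.length) (x₂ := 0 + 2)
        ⟨by omega, le_rfl⟩ ⟨by omega, hi⟩ h
      omega
    · have := hp.getVert_injOn (x₁ := i) (x₂ := i + 2)
        ⟨by omega, by omega⟩ ⟨by omega, hi⟩ h
      omega
  obtain ⟨k, hk⟩ := even_length_quaternionGraph q hq2 p
  obtain ⟨w, a, U, h1, h2, -, h4, h5⟩ := exists_word q hq2 hadj hne (p.length - 1) (by omega)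
  rw [Nat.sub_add_cancel (by omega)] at h2 h5
  -- Closing up means that the word is scalar modulo q.
  rw [p.getVert_length, p.getVert_zero, left_eq_mul, QuotientGroup.eq_one_iff,
    mem_scalarUnits] at h5
  obtain ⟨c, hc⟩ := h5
  generalize w * letter (p.getVert (p.length - 1)).2 a = W at h1 h2 h4
  rw [h4, QuaternionAlgebra.algebraMap_eq, QuaternionAlgebra.ext_iff] at hc
  obtain ⟨-, hI, hJ, hK⟩ := hc
  rw [hk, ← two_mul] at h2 ⊢
  exact pow_four_le_of_scalar_mod Fact.out hq2 (by omega) h2 h1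
    ((ZMod.intCast_zmod_eq_zero_iff_dvd _ q).1 hI.symm)
    ((ZMod.intCast_zmod_eq_zero_iff_dvd _ q).1 hJ.symm)
    ((ZMod.intCast_zmod_eq_zero_iff_dvd _ q).1 hK.symm)

end CubicGraph

/-! ### Assembly of the family -/

/-- A connected component of a finite graph, transported to an initial segment of `ℕ`. -/
theorem exists_component_on_fin {W : Type*} [Finite W] [Nonempty W] (X : SimpleGraph W) :
    ∃ (n : ℕ) (j : Fin n ↪ W), (X.comap j).Connected ∧
      ∀ a w, X.Adj (j a) w → w ∈ Set.range j := by
  let C := X.connectedComponentMk (Classical.arbitrary W)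
  let e : C.supp ≃ Fin (Nat.card C.supp) := Finite.equivFin _
  refine ⟨_, e.symm.toEmbedding.trans (Function.Embedding.subtype _), ?_, ?_⟩
  · let φ : X.comap (e.symm.toEmbedding.trans (Function.Embedding.subtype _)) ≃g C.toSimpleGraph :=
      { toEquiv := e.symm
        map_rel_iff' := Iff.rfl }
    exact φ.connected_iff.2 C.connected_toSimpleGraph
  · intro a w h
    have hw : w ∈ C.supp := (C.mem_supp_congr_adj h).1 (e.symm a).2
    exact ⟨e ⟨w, hw⟩, congrArg Subtype.val (e.symm_apply_apply ⟨w, hw⟩)⟩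

/-- Connected cubic graphs on at most `4 q ^ 3` vertices with girth at least `4 log₂ q - 4`. -/
theorem exists_cubic_graph (q : ℕ) (hq : q.Prime) (hq2 : q ≠ 2) :
    ∃ (n : ℕ) (G : SimpleGraph (Fin n)) (_ : DecidableRel G.Adj), G.Connected ∧
      G.IsRegularOfDegree 3 ∧ n ≤ 4 * q ^ 3 ∧ 0 < betti G ∧ q ^ 4 ≤ 2 ^ (G.girth + 4) := by
  classical
  have : Fact q.Prime := ⟨hq⟩
  obtain ⟨n, j, hconn, hj⟩ := exists_component_on_fin (quaternionGraph q hq2)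
  have hreg : ((quaternionGraph q hq2).comap j).IsRegularOfDegree 3 := by
    intro v
    rw [← ncard_neighborSet_quaternionGraph q hq2 (j v), ← SimpleGraph.card_neighborSet_eq_degree,
      ← Nat.card_eq_fintype_card, Nat.card_coe_set_eq, ← Set.ncard_image_of_injective _ j.injective]
    congr 1
    ext w
    constructor
    · rintro ⟨a, ha, rfl⟩
      exact ha
    · intro hw
      obtain ⟨a, rfl⟩ := hj v w hw
      exact ⟨a, hw, rfl⟩
  have hb : 0 < betti ((quaternionGraph q hq2).comap j) := by
    have h1 := card_edgeSet_of_regular _ hreg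
    have h2 := card_edgeSet_le_of_regular _ hreg
    have h3 : 0 < Fintype.card (Fin n) := Fintype.card_pos_iff.2 hconn.nonempty
    omega
  refine ⟨n, _, inferInstance, hconn, hreg, ?_, hb, ?_⟩
  · have h1 := Nat.card_le_card_of_injective _ j.injective
    rw [Nat.card_prod, Nat.card_fin, Nat.card_eq_fintype_card (α := Bool), Fintype.card_bool] at h1
    have h2 := card_projectiveUnits_le q
    omega
  · have hcyc : ¬ ((quaternionGraph q hq2).comap j).IsAcyclic := by
      intro hac
      obtain ⟨v, w, hw, -⟩ := exists_cycle_of_betti_pos _ hb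
      exact hac w hw
    obtain ⟨v, w, hw, hl⟩ := SimpleGraph.exists_girth_eq_length.2 hcyc
    rw [hl]
    have := pow_four_le_of_isCycle q hq2
      (hw.map (f := (SimpleGraph.Embedding.comap j (quaternionGraph q hq2)).toHom) j.injective)
    rwa [SimpleGraph.Walk.length_map] at this

/-- Connected cubic graphs of arbitrarily large Betti number with girth at least
`(4 / 3) log₂ b - 8`. -/
theorem exists_cubic_graph_large_girth (B : ℕ) :
    ∃ (n : ℕ) (G : SimpleGraph (Fin n)) (_ : DecidableRel G.Adj), G.Connected ∧
      G.IsRegularOfDegree 3 ∧ B ≤ betti G ∧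
      4 / 3 * Real.logb 2 (betti G) - 8 ≤ (G.girth : ℝ) := by
  -- The exponent forces girth ≥ 3B; since girth ≤ |E| ≤ 3b, this gives b ≥ B. The summand 3
  -- excludes q = 2.
  obtain ⟨q, hBq, hq⟩ := Nat.exists_infinite_primes (2 ^ (3 * B + 4) + 3)
  obtain ⟨n, G, hdec, hconn, hreg, hn, hb, hg⟩ := exists_cubic_graph q hq (by
    have := Nat.one_le_two_pow (n := 3 * B + 4)
    omega)
  refine ⟨n, G, hdec, hconn, hreg, ?_, ?_⟩
  · have h1 : 3 * B + 4 ≤ G.girth + 4 := by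
      rw [← Nat.pow_le_pow_iff_right (a := 2) (by norm_num)]
      calc 2 ^ (3 * B + 4) ≤ q := by omega
        _ ≤ q ^ 4 := Nat.le_self_pow (by norm_num) q
        _ ≤ _ := hg
    obtain ⟨v, w, hw, hl⟩ := exists_cycle_of_betti_pos G hb
    have h2 := SimpleGraph.girth_le_length hw
    have h4 := card_edgeSet_le_of_regular G hreg
    omega
  · have h1 : betti G ≤ 6 * q ^ 3 := by
      have h2 := card_edgeSet_of_regular G hreg
      have h3 := betti_le_card_edgeSet G
      rw [Fintype.card_fin] at h2
      omega
    have hq0 : (0 : ℝ) < q := by exact_mod_cast hq.pos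
    have h2 : Real.logb 2 (betti G) ≤ 3 + 3 * Real.logb 2 q := by
      calc Real.logb 2 (betti G) ≤ Real.logb 2 (2 ^ 3 * (q : ℝ) ^ 3) := by
            apply Real.logb_le_logb_of_le (by norm_num) (by exact_mod_cast hb)
            have : betti G ≤ 2 ^ 3 * q ^ 3 := h1.trans (by gcongr; norm_num)
            exact_mod_cast this
        _ = _ := by
            rw [Real.logb_mul (by positivity) (by positivity), Real.logb_pow, Real.logb_pow,
              Real.logb_self_eq_one (by norm_num)]
            norm_num
    have h3 : 4 * Real.logb 2 q ≤ G.girth + 4 := by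
      have h4 : Real.logb 2 ((q : ℝ) ^ 4) ≤ Real.logb 2 (2 ^ (G.girth + 4)) := by
        apply Real.logb_le_logb_of_le (by norm_num) (by positivity)
        exact_mod_cast hg
      rw [Real.logb_pow, Real.logb_pow, Real.logb_self_eq_one (by norm_num)] at h4
      push_cast at h4
      linarith
    -- 4 log₂ q - 4 ≥ (4/3)(log₂ b - 3) - 4 = (4/3) log₂ b - 8.
    linarith

/-- There is a large girth cubic family with strictly increasing Betti numbers. -/
theorem exists_isLargeGirthCubicFamily :
    ∃ (n : ℕ → ℕ) (G : ∀ m, SimpleGraph (Fin (n m))) (_ : ∀ m, DecidableRel (G m).Adj),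
      IsLargeGirthCubicFamily G ∧ StrictMono (fun m => betti (G m)) := by
  -- Indexing by the Betti number itself makes the extracted sequence strictly increasing in b.
  have hfreq : ∃ᶠ b in atTop, ∃ (n : ℕ) (G : SimpleGraph (Fin n)) (_ : DecidableRel G.Adj),
      G.Connected ∧ G.IsRegularOfDegree 3 ∧ betti G = b ∧
      4 / 3 * Real.logb 2 (betti G) - 8 ≤ (G.girth : ℝ) := by
    rw [frequently_atTop]
    intro B
    obtain ⟨n, G, hdec, h1, h2, h3, h4⟩ := exists_cubic_graph_large_girth B
    exact ⟨betti G, h3, n, G, hdec, h1, h2, rfl, h4⟩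
  obtain ⟨φ, hφ, hex⟩ := extraction_of_frequently_atTop hfreq
  choose n G hdec hconn hreg hbetti hgirth using hex
  have hbf : (fun m => betti (G m)) = φ := funext hbetti
  have htend : Tendsto (fun m => betti (G m)) atTop atTop := hbf ▸ hφ.tendsto_atTop
  refine ⟨n, G, hdec, ⟨hconn, hreg, htend, ?_⟩, hbf ▸ hφ⟩
  intro ε hε
  -- The additive loss 8 is absorbed by ε times the diverging logarithm.
  have hlog : Tendsto (fun m => ε * (4 / 3 * Real.logb 2 (betti (G m) : ℝ))) atTop atTop :=
    (((Real.tendsto_logb_atTop (by norm_num)).comp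
      (tendsto_natCast_atTop_atTop.comp htend)).const_mul_atTop (by norm_num)).const_mul_atTop hε
  filter_upwards [hlog.eventually_ge_atTop 8] with m hm
  have := hgirth m
  linarith

end GraphJacobian

end

theorem mainTheorem6 :
    (∃ (n : ℕ → ℕ) (G : ∀ m, SimpleGraph (Fin (n m))) (_ : ∀ m, DecidableRel (G m).Adj),
      GraphJacobian.IsLargeGirthCubicFamily G ∧
      StrictMono (fun m => GraphJacobian.betti (G m)) ∧
      GraphJacobian.AsympGE
        (fun m => GraphJacobian.hermiteInvariant (GraphJacobian.jacobian (G m)))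
        (fun m => 4 / (9 * Real.exp 1) * Real.logb 2 (GraphJacobian.betti (G m) : ℝ))) ∧
    (∀ (V : ℕ → Type*) [∀ m, Fintype (V m)] [∀ m, DecidableEq (V m)]
      (G : ∀ m, SimpleGraph (V m)) [∀ m, DecidableRel (G m).Adj],
      GraphJacobian.IsLargeGirthCubicFamily G →
      GraphJacobian.AsympGE
        (fun m => GraphJacobian.hermiteInvariant (GraphJacobian.jacobian (G m)))
        (fun m => 4 / (9 * Real.exp 1) * Real.logb 2 (GraphJacobian.betti (G m) : ℝ))) := by
  obtain ⟨n, G, hdec, hG, hmono⟩ := GraphJacobian.exists_isLargeGirthCubicFamily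
  refine ⟨⟨n, G, hdec, hG, hmono, hG.hermiteInvariant_asympGE⟩, ?_⟩
  intro V _ _ G _ hG
  exact hG.hermiteInvariant_asympGE
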